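/- All rings are commutative with unit, and classes of modules are considered up to isomorphism. Let $\mathfrak R$ be a class of commutative rings, and for each commutative ring $R$ let $\mathcal C_R$ be a class of $R$-modules, with $\mathcal C_R\neq\emptyset$ for $R\in\mathfrak R$. Notation. For a class $\mathcal B$ of $R$-modules let $\mathcal B^\intercal=\{D : \mathrm{Tor}_1^R(B,D)=0 \text{ for all } B\in\mathcal B\}$. A class of $R$-modules is definable if it is closed under direct limits, direct products and pure submodules; $\mathrm{Def}\,\mathcal Q$ is the least definable class containing $\mathcal Q$. A module $M$ is $\mathcal Q$-Mittag-Leffler if for each family $(Q_i)_{i\in I}$ of members of $\mathcal Q$ the canonical map $M\otimes_R\prod_{i} Q_i\to\prod_{i} (M\otimes_R Q_i)$ is injective. For a ring homomorphism $R\to S$, $\mathcal C_R\otimes_R S=\{M\otimes_R S : M\in\mathcal C_R\}$. Let $\mathfrak P$ be the following property of modules: an $R$-module $M$ has $\mathfrak P$, written $M\in\mathfrak P(R)$, if and only if $M$ is flat and $\mathrm{Def}(\mathcal C_R^\intercal)$-Mittag-Leffler. Assume: (C1) $\mathcal C_R\otimes_R S\subseteq\mathcal C_S$ for each flat ring homomorphism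 $R\to S$ with $R,S\in\mathfrak R$. (C2) $\mathrm{Def}(\mathcal C_S^\intercal)=\mathrm{Def}\big((\mathcal C_R\otimes_R S)^\intercal\big)$ for each faithfully flat ring homomorphism $R\to S$ where $R\in\mathfrak R$ and $S$ is a finite direct product of rings in $\mathfrak R$. (C3) If $S=\prod_{i<n}R_i$ with $R_i\in\mathfrak R$ for each $i<n$, then $\mathcal C_S=\prod_{i<n}\mathcal C_{R_i}=\{\prod_{i<n}M_i : M_i\in\mathcal C_{R_i}\}$. Then $\mathfrak P$ is an ad-property in $\mathfrak R$, that is: (a) if $R\to S$ is a flat ring homomorphism with $R,S\in\mathfrak R$ and $M\in\mathfrak P(R)$, then $M\otimes_R S\in\mathfrak P(S)$; (b) if $R\to S$ is a faithfully flat ring homomorphism where $R\in\mathfrak R$ and $S$ is a finite direct product of rings in $\mathfrak R$, and $M$ is an $R$-module with $M\otimes_R S\in\mathfrak P(S)$, then $M\in\mathfrak P(R)$; (c) if $R=\prod_{i<n}R_i$ with $R_i\in\mathfrak R$ and $M_i\in\mathfrak P(R_i)$ for each $i<n$, then $\prod_{i<n}M_i\in\mathfrak P(R)$. Moreover, the notion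 of a locally $\mathfrak P$-quasi-coherent sheaf is Zariski local on the class of all locally $\mathfrak R$-schemes, that is: let $X$ be a scheme such that $\mathcal O_X(U)\in\mathfrak R$ for each affine open $U\subseteq X$, let $X=\bigcup_{V\in\mathcal V}V$ be an affine open covering, and let $\mathcal M$ be a quasi-coherent sheaf on $X$ with $\mathcal M(V)\in\mathfrak P(\mathcal O_X(V))$ for all $V\in\mathcal V$; then $\mathcal M(U)\in\mathfrak P(\mathcal O_X(U))$ for each affine open $U\subseteq X$. -/

import Mathlib

universe u

open CategoryTheory CategoryTheory.Limits AlgebraicGeometry TensorProduct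

namespace RelML

/-- A class of commutative rings. -/
abbrev RingClass := ∀ (R : Type u) [CommRing R], Prop

/-- A class of `R`-modules for every commutative ring `R`, i.e. a property of modules. -/
abbrev ModuleClasses := ∀ (R : Type u) [CommRing R], ObjectProperty (ModuleCat.{u} R)

section Modules

variable {R : Type u} [CommRing R]

/-- `M` is Mittag-Leffler relative to `Q`: for every family `(Q i)` of members of `Q` the canonical
map `M ⊗ ∏ Q i → ∏ (M ⊗ Q i)`, `m ⊗ (q i) ↦ (m ⊗ q i)`, is injective. -/
def IsMittagLeffler (Q : ObjectProperty (ModuleCat.{u} R)) (M : ModuleCat.{u} R) : Prop :=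
  ∀ (I : Type u) (N : I → ModuleCat.{u} R), (∀ i, Q (N i)) →
    Function.Injective (TensorProduct.piRightHom R R M (fun i => N i))

/-- The class of all `D` with `Tor₁ᴿ(B, D) = 0` for all `B` in the given class.
(Here `Tor` is computed from a projective resolution of its first argument `B`.) -/
def torOrth (B : ObjectProperty (ModuleCat.{u} R)) : ObjectProperty (ModuleCat.{u} R) :=
  fun D => ∀ X : ModuleCat.{u} R, B X → IsZero (((Tor' (ModuleCat.{u} R) 1).obj X).obj D)

/-- A submodule is pure if its inclusion stays injective after tensoring with any module. -/
def IsPureSubmodule {M : Type u} [AddCommGroup M] [Module R M] (N : Submodule R M) : Prop :=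
  ∀ X : ModuleCat.{u} R, Function.Injective (N.subtype.rTensor X)

/-- A class of modules is definable if it is closed under direct limits (colimits of direct systems
indexed by nonempty directed posets; this includes closure under isomorphism), direct products
and pure submodules. -/
structure IsDefinable (D : ObjectProperty (ModuleCat.{u} R)) : Prop where
  directLimit : ∀ (J : Type u) [PartialOrder J] [IsDirectedOrder J] [Nonempty J]
    (F : J ⥤ ModuleCat.{u} R) (c : Cocone F), Nonempty (IsColimit c) →
    (∀ j, D (F.obj j)) → D c.pt
  prod : ∀ (I : Type u) (N : I → ModuleCat.{u} R), (∀ i, D (N i)) → D (ModuleCat.of R (∀ i, N i))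
  pure : ∀ (M : ModuleCat.{u} R) (N : Submodule R M), D M → IsPureSubmodule N →
    D (ModuleCat.of R N)

/-- `Def Q`, the least definable class containing `Q`. -/
def definableClosure (Q : ObjectProperty (ModuleCat.{u} R)) : ObjectProperty (ModuleCat.{u} R) :=
  fun M => ∀ D : ObjectProperty (ModuleCat.{u} R), IsDefinable D → Q ≤ D → D M

/-- The class `C ⊗_R S` of the `S`-modules (isomorphic to) `S ⊗_R M` with `M` in `C`. -/
def baseChange (C : ObjectProperty (ModuleCat.{u} R)) (S : Type u) [CommRing S] [Algebra R S] :
    ObjectProperty (ModuleCat.{u} S) :=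
  fun N => ∃ M : ModuleCat.{u} R, C M ∧ Nonempty (N ≅ ModuleCat.of S (S ⊗[R] M))

end Modules

/-- The `S`-module `∏ M i`, where `S` is identified with `∏ R i` by `e` and acts componentwise. -/
noncomputable def prodModule {n : ℕ} {R : Fin n → Type u} [∀ i, CommRing (R i)]
    {S : Type u} [CommRing S] (e : S ≃+* (∀ i, R i)) (M : ∀ i, ModuleCat.{u} (R i)) :
    ModuleCat.{u} S :=
  (ModuleCat.restrictScalars (e : S →+* (∀ i, R i))).obj
    (ModuleCat.of (∀ i, R i) (∀ i, M i))

/-- The class `∏ C_{R i}` of the `S`-modules (isomorphic to) `∏ M i` with `M i` in `C_{R i}`. -/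
def prodClass (C : ModuleClasses.{u}) {n : ℕ} {R : Fin n → Type u} [∀ i, CommRing (R i)]
    {S : Type u} [CommRing S] (e : S ≃+* (∀ i, R i)) : ObjectProperty (ModuleCat.{u} S) :=
  fun N => ∃ M : ∀ i, ModuleCat.{u} (R i), (∀ i, C (R i) (M i)) ∧ Nonempty (N ≅ prodModule e M)

/-- `S` is (isomorphic to) a finite direct product of rings from `𝔯`. -/
def IsFiniteProductOf (𝔯 : RingClass.{u}) (S : Type u) [CommRing S] : Prop :=
  ∃ (n : ℕ) (R : Fin n → Type u) (_ : ∀ i, CommRing (R i)),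
    (∀ i, 𝔯 (R i)) ∧ Nonempty (S ≃+* (∀ i, R i))

/-- `P` ascends along flat morphisms in `𝔯`, descends along faithfully flat morphisms in `𝔯`, and
is compatible with finite ring direct products. -/
structure IsAdProperty (𝔯 : RingClass.{u}) (P : ModuleClasses.{u}) : Prop where
  ascent : ∀ (R S : Type u) [CommRing R] [CommRing S] [Algebra R S], 𝔯 R → 𝔯 S →
    Module.Flat R S → ∀ M : ModuleCat.{u} R, P R M → P S (ModuleCat.of S (S ⊗[R] M))
  descent : ∀ (R S : Type u) [CommRing R] [CommRing S] [Algebra R S], 𝔯 R →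
    IsFiniteProductOf 𝔯 S → Module.FaithfullyFlat R S →
    ∀ M : ModuleCat.{u} R, P S (ModuleCat.of S (S ⊗[R] M)) → P R M
  prod : ∀ (n : ℕ) (R : Fin n → Type u) [∀ i, CommRing (R i)] (S : Type u) [CommRing S]
    (e : S ≃+* (∀ i, R i)), (∀ i, 𝔯 (R i)) → ∀ M : ∀ i, ModuleCat.{u} (R i),
    (∀ i, P (R i) (M i)) → P S (prodModule e M)

/-- The ring of sections of `X` over each open affine set belongs to `𝔯`. -/
def IsLocallyScheme (𝔯 : RingClass.{u}) (X : Scheme.{u}) : Prop :=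
  ∀ U : X.Opens, IsAffineOpen U → 𝔯 Γ(X, U)

/-- The `Γ(X, U)`-module of sections `Γ(M, U)` satisfies `P`. -/
def SectionsSatisfy (P : ModuleClasses.{u}) {X : Scheme.{u}} (M : X.Modules) (U : X.Opens) : Prop :=
  P Γ(X, U) (ModuleCat.of Γ(X, U) Γ(M, U))

/-- The quasi-coherent sheaf `M` is locally `P`-quasi-coherent. -/
def IsLocallyQCoh (P : ModuleClasses.{u}) {X : Scheme.{u}} (M : X.Modules) : Prop :=
  M.IsQuasicoherent ∧ ∀ U : X.Opens, IsAffineOpen U → SectionsSatisfy P M U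

/-- The notion of a locally `P`-quasi-coherent sheaf is Zariski local on the class of all
locally `𝔯`-schemes. -/
def IsZariskiLocal (𝔯 : RingClass.{u}) (P : ModuleClasses.{u}) : Prop :=
  ∀ X : Scheme.{u}, IsLocallyScheme 𝔯 X →
    ∀ 𝒱 : Set X.Opens, (∀ V ∈ 𝒱, IsAffineOpen V) → sSup 𝒱 = ⊤ →
      ∀ M : X.Modules, M.IsQuasicoherent → (∀ V ∈ 𝒱, SectionsSatisfy P M V) → IsLocallyQCoh P M

/-- The property of being a flat `Def (C_Rᵀ)`-Mittag-Leffler module, where `C_Rᵀ` is the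
`Tor₁`-orthogonal class of `C_R`. -/
def flatML (C : ModuleClasses.{u}) : ModuleClasses.{u} :=
  fun R _ M => Module.Flat R M ∧ IsMittagLeffler (definableClosure (torOrth (C R))) M

/-- For flat `R → S` with `R, S` in `𝔯`: `C_R ⊗_R S ⊆ C_S` (up to isomorphism). -/
def CondC1 (𝔯 : RingClass.{u}) (C : ModuleClasses.{u}) : Prop :=
  ∀ (R S : Type u) [CommRing R] [CommRing S] [Algebra R S], 𝔯 R → 𝔯 S → Module.Flat R S →
    baseChange (C R) S ≤ (C S).isoClosure

/-- For faithfully flat `R → S` with `R` in `𝔯` and `S` a finite direct product of rings in `𝔯`: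
`Def (C_Sᵀ) = Def ((C_R ⊗_R S)ᵀ)`. -/
def CondC2 (𝔯 : RingClass.{u}) (C : ModuleClasses.{u}) : Prop :=
  ∀ (R S : Type u) [CommRing R] [CommRing S] [Algebra R S], 𝔯 R → IsFiniteProductOf 𝔯 S →
    Module.FaithfullyFlat R S →
    definableClosure (torOrth (C S)) = definableClosure (torOrth (baseChange (C R) S))

/-- If `S = ∏ R i` is a finite product with all `R i` in `𝔯`, then `C_S = ∏ C_{R i}`
(up to isomorphism). -/
def CondC3 (𝔯 : RingClass.{u}) (C : ModuleClasses.{u}) : Prop :=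
  ∀ (n : ℕ) (R : Fin n → Type u) [∀ i, CommRing (R i)] (S : Type u) [CommRing S]
    (e : S ≃+* (∀ i, R i)), (∀ i, 𝔯 (R i)) → (C S).isoClosure = prodClass C e

end RelML

/-! A property of every module in `Def Q` can be checked on `Q` alone once the modules with that
property form a definable class. All three ad-conditions use this.

Ascent: the `S`-modules whose restriction to `R` lies in `Def(C_Rᵀ)` form a definable class. It
contains `C_Sᵀ`, because for flat `S` the vanishing of `Tor₁` for `S ⊗ B` and `D` over `S` gives it
for `B` and `D` over `R`, and C1 applies to `S ⊗ B`. As `(S ⊗ M) ⊗_S N` is `M ⊗_R N`, the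
Mittag-Leffler condition passes up.

Descent: the `R`-modules that embed purely into the restriction of a member of `Def(C_Sᵀ)` form a
definable class (`IsDefinable.submodules_restrictScalars`). For `D` in `C_Rᵀ` the map `D → S ⊗ D` is
pure by faithful flatness, and `S ⊗ D` is orthogonal to `C_R ⊗ S`, so C2 applies. Products of pure
maps are pure (`piMap_rTensor_injective`), so the Mittag-Leffler condition passes to pure
submodules.

Products: each factor `R i` is a direct summand of `S`, so `R i ⊗ -` commutes with products. By C3
and nonemptiness it carries `Def(C_Sᵀ)` into `Def(C_{R i}ᵀ)`.

Zariski locality is the affine communication lemma: ascent handles basic opens, and products with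
descent handle finite basic covers, since sections of a quasi-coherent sheaf localize. -/

namespace RelML

/-! ### Definable classes -/

section Definable

variable {R : Type u} [CommRing R]

/-- Any isomorphic copy of `M` is a colimit of the one-point diagram at `M`. -/
theorem IsDefinable.of_iso {D : ObjectProperty (ModuleCat.{u} R)} (hD : IsDefinable D)
    {M N : ModuleCat.{u} R} (e : M ≅ N) (hM : D M) : D N := by
  let F : PUnit.{u + 1} ⥤ ModuleCat.{u} R := (Functor.const _).obj M
  let c : Cocone F := ⟨N, { app := fun _ => e.hom, naturality := by intros; simp [F] }⟩
  refine hD.directLimit PUnit.{u + 1} F c ⟨?_⟩ fun _ => hM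
  exact
    { desc := fun s => e.inv ≫ s.ι.app PUnit.unit
      fac := fun s j => by simp [c]
      uniq := fun s m hm => by simp [← hm PUnit.unit, c] }

theorem IsDefinable.of_linearEquiv {D : ObjectProperty (ModuleCat.{u} R)} (hD : IsDefinable D)
    {M N : ModuleCat.{u} R} (e : M ≃ₗ[R] N) (hM : D M) : D N :=
  hD.of_iso e.toModuleIso hM

theorem isDefinable_definableClosure (Q : ObjectProperty (ModuleCat.{u} R)) :
    IsDefinable (definableClosure Q) where
  directLimit J _ _ _ F c hc h D hD hQ := hD.directLimit J F c hc fun j => h j D hD hQ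
  prod I N h D hD hQ := hD.prod I N fun i => h i D hD hQ
  pure M N hM hN D hD hQ := hD.pure M N (hM D hD hQ) hN

theorem le_definableClosure (Q : ObjectProperty (ModuleCat.{u} R)) : Q ≤ definableClosure Q :=
  fun _ hM _ _ hQ => hQ _ hM

theorem definableClosure_le {Q D : ObjectProperty (ModuleCat.{u} R)} (hD : IsDefinable D)
    (h : Q ≤ D) : definableClosure Q ≤ D :=
  fun _ hM => hM D hD h

theorem IsDefinable.of_universallyInjective {D : ObjectProperty (ModuleCat.{u} R)}
    (hD : IsDefinable D) {N E : ModuleCat.{u} R} (f : N →ₗ[R] E)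
    (hf : ∀ X : ModuleCat.{u} R, Function.Injective (f.rTensor X)) (hE : D E) : D N := by
  -- Testing purity against `R` itself recovers plain injectivity.
  have hinj : Function.Injective f := by
    intro x y hxy
    have : f.rTensor (ModuleCat.of R R) (x ⊗ₜ (1 : R)) =
        f.rTensor (ModuleCat.of R R) (y ⊗ₜ (1 : R)) := by
      simp [hxy]
    simpa using congrArg (TensorProduct.rid R N) (hf _ this)
  let e := LinearEquiv.ofInjective f hinj
  refine hD.of_iso e.toModuleIso.symm (hD.pure E (LinearMap.range f) hE fun X => ?_)
  have h : (LinearMap.range f).subtype ∘ₗ e.toLinearMap = f := by ext; rfl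
  have h2 := hf X
  rw [← h, LinearMap.rTensor_comp] at h2
  exact Function.Injective.of_comp_right h2 (e.rTensor X).surjective

end Definable

/-! ### Purity, linear systems and products -/

section Pure

variable {R : Type u} [CommRing R]

/-- A universally injective linear map reflects solvability of finite linear systems. -/
theorem exists_solution_of_universallyInjective {N E : ModuleCat.{u} R} (f : N →ₗ[R] E)
    (hf : ∀ X : ModuleCat.{u} R, Function.Injective (f.rTensor X))
    {ι : Type} [Fintype ι] {k : ℕ} (a : ι → Fin k → R) (n : ι → N) (y : Fin k → E)
    (h : ∀ j, f (n j) = ∑ l, a j l • y l) :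
    ∃ y' : Fin k → N, ∀ j, n j = ∑ l, a j l • y' l := by
  classical
  -- The test module is the cokernel of the coefficient matrix. A solution in `E` makes `∑ n j ⊗ b
  -- j` vanish after applying `f`, hence before, by purity.
  let K : Submodule R (ι → R) := Submodule.span R (Set.range fun l j => a j l)
  let X : ModuleCat.{u} R := ModuleCat.of R ((ι → R) ⧸ K)
  let b : ι → X := fun j => K.mkQ (Pi.single j 1)
  have hb (v : ι → R) : ∑ j, v j • b j = K.mkQ v := by
    simp only [b, ← map_smul, ← map_sum]
    congr 1
    ext i
    simp [Finset.sum_apply, Pi.single_apply]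
  have hcol (l : Fin k) : ∑ j, a j l • b j = 0 := by
    rw [hb]
    exact (Submodule.Quotient.mk_eq_zero _).mpr (Submodule.subset_span ⟨l, rfl⟩)
  have hzero : ∑ j, n j ⊗ₜ[R] b j = 0 := by
    apply hf X
    rw [map_zero, map_sum]
    simp only [LinearMap.rTensor_tmul, h, sum_tmul]
    rw [Finset.sum_comm]
    refine Finset.sum_eq_zero fun l _ => ?_
    simp only [smul_tmul]
    rw [← tmul_sum, hcol, tmul_zero]
  have hzero' : ∑ j, b j ⊗ₜ[R] n j = 0 := by
    have := congrArg (TensorProduct.comm R N X) hzero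
    simpa using this
  have hspan : Submodule.span R (Set.range b) = ⊤ := by
    rw [eq_top_iff]
    rintro x -
    obtain ⟨v, rfl⟩ := K.mkQ_surjective x
    rw [← hb]
    exact Submodule.sum_mem _ fun j _ => Submodule.smul_mem _ _ (Submodule.subset_span ⟨j, rfl⟩)
  -- By the equational criterion the vanishing is witnessed by columns lying in `K`; their
  -- coordinates `d` in the columns of `a` assemble the solution.
  obtain ⟨k', c, z, hz, hc⟩ := vanishesTrivially_of_sum_tmul_eq_zero R hspan hzero'
  have hmem (i : Fin k') : (fun j => c j i) ∈ K := by
    have := hc i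
    rw [hb] at this
    exact (Submodule.Quotient.mk_eq_zero _).mp this
  choose d hd using fun i => (Submodule.mem_span_range_iff_exists_fun R).mp (hmem i)
  refine ⟨fun l => ∑ i, d i l • z i, fun j => ?_⟩
  rw [hz j]
  simp only [Finset.smul_sum]
  rw [Finset.sum_comm]
  refine Finset.sum_congr rfl fun i _ => ?_
  have := congrFun (hd i) j
  simp only [Finset.sum_apply, Pi.smul_apply, smul_eq_mul] at this
  rw [← this, Finset.sum_smul]
  exact Finset.sum_congr rfl fun l _ => by rw [smul_smul, mul_comm]

/-- A product of universally injective maps is universally injective. -/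
theorem piMap_rTensor_injective {I : Type u} {N E : I → ModuleCat.{u} R}
    (f : ∀ i, N i →ₗ[R] E i)
    (hf : ∀ i, ∀ X : ModuleCat.{u} R, Function.Injective ((f i).rTensor X))
    (X : ModuleCat.{u} R) : Function.Injective ((LinearMap.piMap f).rTensor X) := by
  rw [← LinearMap.lTensor_inj_iff_rTensor_inj]
  have key (Y : Submodule R X) (hY : Y.FG) (x : Y ⊗[R] (∀ i, N i))
      (hx : (LinearMap.piMap f).lTensor Y x = 0) : x = 0 := by
    obtain ⟨k, m, n, rfl⟩ := exists_sum_tmul_eq x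
    have : Module.Finite R Y := Module.Finite.iff_fg.mpr hY
    obtain ⟨l, g, hg⟩ := Module.Finite.exists_fin (R := R) (M := Y)
    -- The equational criterion needs first factors that generate, so generators of `Y` are adjoined
    -- with second factor zero.
    let m' : Fin k ⊕ Fin l → Y := Sum.elim m g
    let n' : Fin k ⊕ Fin l → ∀ i, N i := Sum.elim n 0
    have hsum : ∑ j, m j ⊗ₜ[R] n j = ∑ j, m' j ⊗ₜ[R] n' j := by
      simp [Fintype.sum_sum_type, m', n']
    have hspan : Submodule.span R (Set.range m') = ⊤ := by
      rw [eq_top_iff, ← hg]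
      apply Submodule.span_mono
      rintro _ ⟨j, rfl⟩
      exact ⟨Sum.inr j, rfl⟩
    rw [hsum] at hx ⊢
    simp only [map_sum, LinearMap.lTensor_tmul] at hx
    obtain ⟨k', c, z, hz, hc⟩ := vanishesTrivially_of_sum_tmul_eq_zero R hspan hx
    -- One finite coefficient matrix `c` serves all coordinates, so the system is solved in each `N
    -- i` separately.
    choose y hy using fun i => exists_solution_of_universallyInjective (f i) (hf i) c
      (fun j => n' j i) (fun l => z l i) (fun j => by simpa using congrFun (hz j) i)
    refine sum_tmul_eq_zero_of_vanishesTrivially R ⟨k', c, fun l i => y i l, fun j => ?_, hc⟩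
    ext i
    simpa using hy i j
  rw [injective_iff_map_eq_zero]
  intro x hx
  -- The element lives over a finitely generated `J`, and its image already vanishes over a larger
  -- finitely generated `P`.
  obtain ⟨J, hJ, x, rfl⟩ := Submodule.exists_fg_le_eq_rTensor_subtype x
  have h1 : J.subtype.rTensor _ ((LinearMap.piMap f).lTensor J x) = J.subtype.rTensor _ 0 := by
    rw [map_zero, ← hx, ← LinearMap.comp_apply, ← LinearMap.comp_apply,
      LinearMap.rTensor_comp_lTensor, LinearMap.lTensor_comp_rTensor]
  obtain ⟨P, hP, hle, h2⟩ := hJ.exists_rTensor_fg_inclusion_eq h1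
  have h3 := key P hP ((Submodule.inclusion hle).rTensor _ x) (by
    rw [map_zero] at h2
    rw [← h2, ← LinearMap.comp_apply, ← LinearMap.comp_apply,
      LinearMap.rTensor_comp_lTensor, LinearMap.lTensor_comp_rTensor])
  have h4 : J.subtype.rTensor (∀ i, N i) x =
      P.subtype.rTensor _ ((Submodule.inclusion hle).rTensor _ x) := by
    rw [← LinearMap.comp_apply, ← LinearMap.rTensor_comp]
    rfl
  rw [h4, h3, map_zero]

end Pure

/-! ### Definable classes under change of rings -/

section ChangeOfRings

variable {R S : Type u} [CommRing R] [CommRing S] [Algebra R S]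

theorem rTensor_baseChange_injective_iff {N M : Type u} [AddCommGroup N] [AddCommGroup M]
    [Module R N] [Module R M] [Module S N] [Module S M] [IsScalarTower R S N] [IsScalarTower R S M]
    (f : N →ₗ[S] M) (X : Type u) [AddCommGroup X] [Module R X] :
    Function.Injective (f.rTensor (S ⊗[R] X)) ↔
      Function.Injective ((f.restrictScalars R).rTensor X) := by
  have h : ⇑((f.restrictScalars R).rTensor X) ∘
      ⇑(AlgebraTensorModule.cancelBaseChange R S S N X) =
      ⇑(AlgebraTensorModule.cancelBaseChange R S S M X) ∘ ⇑(f.rTensor (S ⊗[R] X)) := by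
    funext x
    induction x with
    | zero => simp
    | add x y hx hy => simp only [Function.comp_apply, map_add] at *; rw [hx, hy]
    | tmul n t =>
      induction t with
      | zero => simp
      | add x y hx hy => simp only [Function.comp_apply, tmul_add, map_add] at *; rw [hx, hy]
      | tmul s x => simp
  rw [← Function.Injective.of_comp_iff' _
    (AlgebraTensorModule.cancelBaseChange R S S N X).bijective, h,
    Function.Injective.of_comp_iff (AlgebraTensorModule.cancelBaseChange R S S M X).injective]

theorem lTensor_baseChange_injective_iff {N M : Type u} [AddCommGroup N] [AddCommGroup M]
    [Module R N] [Module R M] (f : N →ₗ[R] M) (Y : Type u) [AddCommGroup Y] [Module R Y]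
    [Module S Y] [IsScalarTower R S Y] :
    Function.Injective ((f.baseChange S).lTensor Y) ↔ Function.Injective (f.lTensor Y) := by
  have hc : ⇑(f.lTensor Y) ∘ ⇑(AlgebraTensorModule.cancelBaseChange R S S Y N) =
      ⇑(AlgebraTensorModule.cancelBaseChange R S S Y M) ∘ ⇑((f.baseChange S).lTensor Y) :=
    congrArg DFunLike.coe (AlgebraTensorModule.lTensor_comp_cancelBaseChange
      (R := R) (A := S) (B := S) (M := Y) f)
  rw [← Function.Injective.of_comp_iff' _
    (AlgebraTensorModule.cancelBaseChange R S S Y N).bijective, hc,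
    Function.Injective.of_comp_iff (AlgebraTensorModule.cancelBaseChange R S S Y M).injective]

instance (N : ModuleCat.{u} S) :
    IsScalarTower R S ((ModuleCat.restrictScalars (algebraMap R S)).obj N) :=
  ⟨fun r s m => by rw [Algebra.smul_def, mul_smul]; rfl⟩

/-- Purity over `R` is purity over `S` tested only on the modules `S ⊗ X`. -/
theorem restrictScalars_universallyInjective {N M : ModuleCat.{u} S} (f : N →ₗ[S] M)
    (hf : ∀ X : ModuleCat.{u} S, Function.Injective (f.rTensor X)) (X : ModuleCat.{u} R) :
    Function.Injective (LinearMap.rTensor X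
      ((ModuleCat.restrictScalars (algebraMap R S)).map (ModuleCat.ofHom f)).hom) := by
  let : Module R N := Module.compHom N (algebraMap R S)
  have : IsScalarTower R S N := ⟨fun r s m => by rw [Algebra.smul_def, mul_smul]; rfl⟩
  let : Module R M := Module.compHom M (algebraMap R S)
  have : IsScalarTower R S M := ⟨fun r s m => by rw [Algebra.smul_def, mul_smul]; rfl⟩
  exact (rTensor_baseChange_injective_iff (R := R) f X).mp (hf (ModuleCat.of S (S ⊗[R] X)))

/-- A class of `R`-modules pulled back to `S`-modules along restriction of scalars. -/
theorem IsDefinable.restrictScalars {D : ObjectProperty (ModuleCat.{u} R)} (hD : IsDefinable D) :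
    IsDefinable fun N : ModuleCat.{u} S =>
      D ((ModuleCat.restrictScalars (algebraMap R S)).obj N) where
  directLimit J _ _ _ F c hc h :=
    hD.directLimit J (F ⋙ ModuleCat.restrictScalars (algebraMap R S))
      ((ModuleCat.restrictScalars (algebraMap R S)).mapCocone c)
      ⟨isColimitOfPreserves _ hc.some⟩ h
  prod I N h := hD.of_linearEquiv
    (N := (ModuleCat.restrictScalars (algebraMap R S)).obj (ModuleCat.of S (∀ i, N i)))
    { AddEquiv.refl (∀ i, N i) with map_smul' := fun _ _ => rfl }
      (hD.prod I (fun i => (ModuleCat.restrictScalars (algebraMap R S)).obj (N i)) h)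
  pure M N hM hN := by
    exact hD.of_universallyInjective _
      (restrictScalars_universallyInjective (R := R) (N := ModuleCat.of S N) N.subtype hN) hM

variable (R S) in
/-- Extension of scalars, with values the modules `S ⊗[R] M`. -/
noncomputable def baseChangeFunctor : ModuleCat.{u} R ⥤ ModuleCat.{u} S where
  obj M := ModuleCat.of S (S ⊗[R] M)
  map f := ModuleCat.ofHom (f.hom.baseChange S)
  map_id M := by ext1; exact LinearMap.baseChange_id
  map_comp f g := by ext1; exact LinearMap.baseChange_comp _ _

/-- The universal property of `S ⊗[R] M`. -/
noncomputable def baseChangeHomEquiv (M : ModuleCat.{u} R) (N : ModuleCat.{u} S) :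
    ((baseChangeFunctor R S).obj M ⟶ N) ≃
      (M ⟶ (ModuleCat.restrictScalars (algebraMap R S)).obj N) :=
  (ConcreteCategory.homEquiv (C := ModuleCat S)).trans <|
    (LinearMap.liftBaseChangeEquiv (R := R) (M := M)
      (N := (ModuleCat.restrictScalars (algebraMap R S)).obj N) S).symm.toEquiv.trans
    (ConcreteCategory.homEquiv (C := ModuleCat R)).symm

variable (R S) in
/-- Extension of scalars is left adjoint to restriction of scalars. -/
noncomputable def baseChangeAdjunction :
    baseChangeFunctor R S ⊣ ModuleCat.restrictScalars (algebraMap R S) :=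
  Adjunction.mkOfHomEquiv
    { homEquiv := baseChangeHomEquiv
      homEquiv_naturality_left_symm := fun {M M' N} f g => by
        ext1
        refine LinearMap.ext fun x => ?_
        change LinearMap.liftBaseChangeEquiv (R := R) (M := M)
            (N := (ModuleCat.restrictScalars (algebraMap R S)).obj N) S (f ≫ g).hom x =
          LinearMap.liftBaseChangeEquiv (R := R) (M := M')
            (N := (ModuleCat.restrictScalars (algebraMap R S)).obj N) S g.hom
              (f.hom.baseChange S x)
        induction (x : S ⊗[R] M) using TensorProduct.induction_on with
        | zero => simp only [map_zero]
        | add x y hx hy => simp only [map_add, hx, hy]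
        | tmul s m => rfl
      homEquiv_naturality_right := fun f g => rfl }

/-- Direct limits and purity survive any base change, but products in general do not, hence the
hypothesis `hprod`. -/
theorem IsDefinable.baseChange {D : ObjectProperty (ModuleCat.{u} S)} (hD : IsDefinable D)
    (hprod : ∀ (I : Type u) (N : I → ModuleCat.{u} R),
      (∀ i, D (ModuleCat.of S (S ⊗[R] N i))) → D (ModuleCat.of S (S ⊗[R] (∀ i, N i)))) :
    IsDefinable fun M : ModuleCat.{u} R => D (ModuleCat.of S (S ⊗[R] M)) where
  directLimit J _ _ _ F c hc h := by
    have : (baseChangeFunctor R S).IsLeftAdjoint := (baseChangeAdjunction R S).isLeftAdjoint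
    exact hD.directLimit J (F ⋙ baseChangeFunctor R S) ((baseChangeFunctor R S).mapCocone c)
      ⟨isColimitOfPreserves _ hc.some⟩ h
  prod := hprod
  pure M N hM hN := by
    refine hD.of_universallyInjective
      (N := ModuleCat.of S (S ⊗[R] N)) (E := ModuleCat.of S (S ⊗[R] M))
      (N.subtype.baseChange S) (fun Y => ?_) hM
    let : Module R Y := Module.compHom Y (algebraMap R S)
    have : IsScalarTower R S Y := ⟨fun r s m => by rw [Algebra.smul_def, mul_smul]; rfl⟩
    rw [← LinearMap.lTensor_inj_iff_rTensor_inj, lTensor_baseChange_injective_iff,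
      LinearMap.lTensor_inj_iff_rTensor_inj]
    exact hN (ModuleCat.of R Y)

/-- Associativity turns the map into `M ⊗ X → S ⊗ (M ⊗ X)`, which is injective by faithful flatness.
-/
theorem mk_one_universallyInjective [Module.FaithfullyFlat R S] (M : ModuleCat.{u} R)
    (X : ModuleCat.{u} R) : Function.Injective ((TensorProduct.mk R S M 1).rTensor X) := by
  have h := Module.FaithfullyFlat.tensorProduct_mk_injective (A := R) (B := S) (M ⊗[R] X)
  have hc : ⇑(TensorProduct.assoc R S M X) ∘ ⇑((TensorProduct.mk R S M 1).rTensor X) =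
      ⇑(TensorProduct.mk R S (M ⊗[R] X) 1) := by
    funext x
    induction x with
    | zero => simp
    | add x y hx hy => simp only [Function.comp_apply, map_add] at *; rw [hx, hy]
    | tmul m x => simp
  rw [← hc] at h
  exact Function.Injective.of_comp h

/-- A filtered colimit of universally injective maps is universally injective. -/
theorem universallyInjective_of_isColimit {J : Type u} [SmallCategory J] [IsFiltered J]
    {F G : J ⥤ ModuleCat.{u} R} (α : F ⟶ G)
    (hα : ∀ j, ∀ X : ModuleCat.{u} R, Function.Injective (LinearMap.rTensor X (α.app j).hom))
    {c : Cocone F} (hc : IsColimit c) {d : Cocone G} (hd : IsColimit d)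
    (X : ModuleCat.{u} R) :
    Function.Injective (LinearMap.rTensor X (hc.map d α).hom) := by
  let T := MonoidalCategory.tensorRight X
  have hTc : IsColimit (T.mapCocone c) := isColimitOfPreserves T hc
  have hTd : IsColimit (T.mapCocone d) := isColimitOfPreserves T hd
  rw [injective_iff_map_eq_zero]
  intro x hx
  -- A kernel element comes from some stage `j`; its image under `α` dies at a later stage `k`,
  -- where injectivity of `α` kills the element itself.
  obtain ⟨j, y, rfl⟩ := Concrete.isColimit_exists_rep (F ⋙ T) hTc x
  have h1 : ∀ y, LinearMap.rTensor X (hc.map d α).hom (((T.mapCocone c).ι.app j).hom y) =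
      ((T.mapCocone d).ι.app j).hom (LinearMap.rTensor X (α.app j).hom y) := by
    intro y
    have h2 : T.map (c.ι.app j) ≫ T.map (hc.map d α) = T.map (α.app j) ≫ T.map (d.ι.app j) := by
      rw [← T.map_comp, ← T.map_comp, IsColimit.ι_map]
    exact congrArg (fun g => g.hom y) h2
  have h3 : ((T.mapCocone d).ι.app j).hom (LinearMap.rTensor X (α.app j).hom y) =
      ((T.mapCocone d).ι.app j).hom 0 := by
    rw [map_zero]
    exact (h1 y).symm.trans hx
  obtain ⟨k, f, g, hfg⟩ := Concrete.isColimit_exists_of_rep_eq (G ⋙ T) hTd _ _ h3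
  have h4 : LinearMap.rTensor X (α.app k).hom ((T.map (F.map f)).hom y) = 0 := by
    have h5 : T.map (F.map f) ≫ T.map (α.app k) = T.map (α.app j) ≫ T.map (G.map f) := by
      rw [← T.map_comp, ← T.map_comp, α.naturality]
    refine (congrArg (fun g => g.hom y) h5).trans ?_
    refine hfg.trans ?_
    exact map_zero ((G ⋙ T).map g).hom
  have h6 : (T.map (F.map f)).hom y = 0 := hα k X (h4.trans (map_zero _).symm)
  have h7 := congrArg (fun g => g.hom y) ((T.mapCocone c).w f)
  refine Eq.trans h7.symm ?_
  change ((T.mapCocone c).ι.app k).hom ((T.map (F.map f)).hom y) = 0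
  rw [h6]
  exact map_zero _

/-- The tail products `∏ k ≥ j, E k` of a family of modules. -/
noncomputable def tailProduct {J : Type u} [PartialOrder J] (E : J → ModuleCat.{u} S) :
    J ⥤ ModuleCat.{u} S where
  obj j := ModuleCat.of S (∀ k : {k : J // j ≤ k}, E k)
  map {i j} h := ModuleCat.ofHom
    (LinearMap.pi fun k => LinearMap.proj (⟨k.1, (leOfHom h).trans k.2⟩ : {k : J // i ≤ k}))

section TailProduct

variable {J : Type u} [PartialOrder J] (F : J ⥤ ModuleCat.{u} R) (E : J → ModuleCat.{u} S)
  (f : ∀ j, F.obj j →ₗ[R] (ModuleCat.restrictScalars (algebraMap R S)).obj (E j))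

/-- The natural map to the tail products induced by maps out of each term of a direct system. -/
noncomputable def toTailProduct :
    F ⟶ tailProduct E ⋙ ModuleCat.restrictScalars (algebraMap R S) where
  app j := ModuleCat.ofHom
    (Y := (ModuleCat.restrictScalars (algebraMap R S)).obj ((tailProduct E).obj j))
    { toFun := fun x k => f k.1 ((F.map (homOfLE k.2)).hom x)
      map_add' := fun x y => by
        funext k
        exact ((f k.1).congr_arg (map_add _ x y)).trans (map_add _ _ _)
      map_smul' := fun r x => by
        funext k
        exact ((f k.1).congr_arg ((F.map (homOfLE k.2)).hom.map_smul r x)).trans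
          ((f k.1).map_smul r _) }
  naturality i j h := by
    ext x
    funext k
    change f k.1 ((F.map (homOfLE k.2)).hom ((F.map h).hom x)) = f k.1 ((F.map _).hom x)
    exact (f k.1).congr_arg (congrArg (fun g => g.hom x) (F.map_comp h (homOfLE k.2))).symm

/-- Projecting to the factor `k = j` recovers `f j`. -/
theorem toTailProduct_universallyInjective
    (hf : ∀ j, ∀ X : ModuleCat.{u} R, Function.Injective ((f j).rTensor X))
    (j : J) (X : ModuleCat.{u} R) :
    Function.Injective (LinearMap.rTensor X ((toTailProduct F E f).app j).hom) := by
  let p : (tailProduct E).obj j ⟶ E j := ModuleCat.ofHom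
    (LinearMap.proj (R := S) (φ := fun k : {k : J // j ≤ k} => E k) ⟨j, le_rfl⟩)
  have hp : ((ModuleCat.restrictScalars (algebraMap R S)).map p).hom ∘ₗ
      ((toTailProduct F E f).app j).hom = f j := by
    refine LinearMap.ext fun x => ?_
    have h : (F.map (homOfLE (le_refl j))).hom x = x := by
      rw [show homOfLE (le_refl j) = 𝟙 j from rfl, F.map_id]
      rfl
    exact (f j).congr_arg h
  have := hf j X
  rw [← hp, LinearMap.rTensor_comp] at this
  exact Function.Injective.of_comp this

end TailProduct

/-- In a direct system the chosen pure embeddings into the `E j` need not be compatible. The tail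
products do form a direct system, receive the given one purely at each stage, and have their colimit
in `D`. -/
theorem IsDefinable.submodules_restrictScalars {D : ObjectProperty (ModuleCat.{u} S)}
    (hD : IsDefinable D) :
    IsDefinable fun N : ModuleCat.{u} R => ∃ (E : ModuleCat.{u} S), D E ∧
      ∃ f : N →ₗ[R] (ModuleCat.restrictScalars (algebraMap R S)).obj E,
        ∀ X : ModuleCat.{u} R, Function.Injective (f.rTensor X) where
  directLimit J _ _ _ F c hc h := by
    choose E hE f hf using h
    obtain ⟨hc⟩ := hc
    have hD' : D (colimit (tailProduct E)) :=
      hD.directLimit J _ (colimit.cocone (tailProduct E)) ⟨colimit.isColimit _⟩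
        fun j => hD.prod _ (fun k : {k : J // j ≤ k} => E k) fun k => hE k.1
    have hd := isColimitOfPreserves (ModuleCat.restrictScalars (algebraMap R S))
      (colimit.isColimit (tailProduct E))
    have hinj := universallyInjective_of_isColimit _
      (toTailProduct_universallyInjective F E f hf) hc hd
    exact ⟨_, hD', _, hinj⟩
  prod I N h := by
    choose E hE f hf using h
    exact ⟨ModuleCat.of S (∀ i, E i), hD.prod I E hE, LinearMap.piMap f,
      piMap_rTensor_injective f hf⟩
  pure M N hM hN := by
    obtain ⟨E, hE, f, hf⟩ := hM
    refine ⟨E, hE, f ∘ₗ N.subtype, fun X => ?_⟩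
    rw [LinearMap.rTensor_comp]
    exact (hf X).comp (hN X)

end ChangeOfRings

/-! ### Vanishing of Tor and flat base change -/

section Tor

variable {R : Type u} [CommRing R]

/-- The vanishing of `Tor₁(B, D)`, expressed by the preservation under `- ⊗ D` of the injectivity
of monomorphisms with cokernel `B`. -/
def TorVanishes (R : Type u) [CommRing R] (B D : Type u) [AddCommGroup B] [Module R B]
    [AddCommGroup D] [Module R D] : Prop :=
  ∀ (X Y : Type u) [AddCommGroup X] [Module R X] [AddCommGroup Y] [Module R Y]
    (i : X →ₗ[R] Y) (p : Y →ₗ[R] B), Function.Injective i → Function.Surjective p →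
    Function.Exact i p → Function.Injective (i.rTensor D)

/-- One projective presentation suffices: lifting `p₀` through `p` exhibits `Y` as the pushout of
`X` and `P` along `K`. -/
theorem torVanishes_of_projective {B D K P : Type u} [AddCommGroup B] [Module R B]
    [AddCommGroup D] [Module R D] [AddCommGroup K] [Module R K] [AddCommGroup P] [Module R P]
    [Module.Projective R P] (i₀ : K →ₗ[R] P) (p₀ : P →ₗ[R] B)
    (hp₀ : Function.Surjective p₀) (h₀ : Function.Exact i₀ p₀)
    (hD : Function.Injective (i₀.rTensor D)) : TorVanishes R B D := by
  intro X Y _ _ _ _ i p hi hp hip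
  obtain ⟨h, hh⟩ := Module.projective_lifting_property p p₀ hp
  have hrange (k : K) : h (i₀ k) ∈ LinearMap.range i := by
    rw [← hip.linearMap_ker_eq, LinearMap.mem_ker, ← LinearMap.comp_apply, hh,
      h₀.apply_apply_eq_zero]
  let e := LinearEquiv.ofInjective i hi
  let g : K →ₗ[R] X := e.symm.toLinearMap ∘ₗ (h ∘ₗ i₀).codRestrict (LinearMap.range i) hrange
  have hg (k : K) : i (g k) = h (i₀ k) := by
    change (e (e.symm _) : Y) = _
    rw [e.apply_symm_apply]
    rfl
  let φ : X × P →ₗ[R] Y := i.coprod h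
  let ψ : K →ₗ[R] X × P := g.prod (-i₀)
  have hφ : Function.Surjective φ := by
    intro y
    obtain ⟨q, hq⟩ := hp₀ (p y)
    have : y - h q ∈ LinearMap.range i := by
      rw [← hip.linearMap_ker_eq, LinearMap.mem_ker, map_sub, ← hq, ← hh, LinearMap.comp_apply,
        sub_self]
    obtain ⟨x, hx⟩ := this
    exact ⟨(x, q), by simp [φ, hx]⟩
  have hex : Function.Exact ψ φ := by
    rintro ⟨x, q⟩
    constructor
    · intro hxq
      have h1 : i x + h q = 0 := by simpa [φ] using hxq
      have h2 : p₀ q = 0 := by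
        have := congrArg p h1
        rw [map_add, hip.apply_apply_eq_zero, zero_add, map_zero] at this
        rw [← hh]
        exact this
      obtain ⟨k, hk⟩ := (h₀ q).mp h2
      refine ⟨-k, Prod.ext ?_ ?_⟩
      · apply hi
        change i (g (-k)) = i x
        rw [hg, map_neg, hk, map_neg, neg_eq_iff_add_eq_zero, add_comm]
        exact h1
      · simp [ψ, hk]
    · rintro ⟨k, hk⟩
      rw [← hk]
      simp [φ, ψ, hg]
  rw [injective_iff_map_eq_zero]
  intro x hx
  have h1 : φ.rTensor D ((LinearMap.inl R X P).rTensor D x) = 0 := by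
    rw [← LinearMap.comp_apply, ← LinearMap.rTensor_comp, LinearMap.coprod_inl, hx]
  obtain ⟨k, hk⟩ := (rTensor_exact D hex hφ _).mp h1
  have h2 : (LinearMap.snd R X P).rTensor D (ψ.rTensor D k) = -(i₀.rTensor D k) := by
    rw [← LinearMap.comp_apply, ← LinearMap.rTensor_comp, LinearMap.snd_prod, LinearMap.rTensor_neg,
      LinearMap.neg_apply]
  -- The `P`-component of `k` is zero and `i₀ ⊗ D` is injective.
  have h3 : k = 0 := by
    apply hD
    rw [map_zero, ← neg_eq_zero, ← h2, hk, ← LinearMap.comp_apply, ← LinearMap.rTensor_comp,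
      LinearMap.snd_comp_inl, LinearMap.rTensor_zero, LinearMap.zero_apply]
  rw [h3, map_zero] at hk
  have h4 := congrArg ((LinearMap.fst R X P).rTensor D) hk
  rw [map_zero, ← LinearMap.comp_apply, ← LinearMap.rTensor_comp, LinearMap.fst_comp_inl,
    LinearMap.rTensor_id] at h4
  exact h4.symm

theorem exact_rTensor_comp_iff {A B K C : Type u} [AddCommGroup A] [Module R A] [AddCommGroup B]
    [Module R B] [AddCommGroup K] [Module R K] [AddCommGroup C] [Module R C] (D : Type u)
    [AddCommGroup D] [Module R D] (d : A →ₗ[R] B) (q : B →ₗ[R] K) (i : K →ₗ[R] C)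
    (hdq : Function.Exact d q) (hq : Function.Surjective q) :
    Function.Exact (d.rTensor D) ((i ∘ₗ q).rTensor D) ↔ Function.Injective (i.rTensor D) := by
  have hex := rTensor_exact D hdq hq
  have hsurj := LinearMap.rTensor_surjective D hq
  rw [LinearMap.rTensor_comp]
  constructor
  · intro h
    rw [injective_iff_map_eq_zero]
    intro z hz
    obtain ⟨w, rfl⟩ := hsurj z
    exact (hex w).mpr ((h w).mp hz)
  · intro h w
    rw [← hex w, LinearMap.comp_apply]
    exact map_eq_zero_iff _ h

/-- Exactness in degree 1 of the resolution tensored with `D` amounts, by right exactness, to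
injectivity of `K ⊗ D → P₀ ⊗ D`, where `K` is the image of `d₁`. -/
theorem isZero_tor_iff (B D : ModuleCat.{u} R) :
    IsZero (((Tor' (ModuleCat.{u} R) 1).obj B).obj D) ↔ TorVanishes R B D := by
  let P := projectiveResolution B
  let T := MonoidalCategory.tensorRight D
  let d₂ : P.complex.X 2 →ₗ[R] P.complex.X 1 := (P.complex.d 2 1).hom
  let d₁ : P.complex.X 1 →ₗ[R] P.complex.X 0 := (P.complex.d 1 0).hom
  let π : P.complex.X 0 →ₗ[R] B := (P.π.f 0).hom
  have hd : Function.Exact d₂ d₁ :=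
    (ShortComplex.ShortExact.moduleCat_exact_iff_function_exact _).mp (P.exact_succ 0)
  have hd₀ : Function.Exact d₁ π :=
    (ShortComplex.ShortExact.moduleCat_exact_iff_function_exact _).mp P.exact₀
  have hπ : Function.Surjective π := (ModuleCat.epi_iff_surjective (P.π.f 0)).mp inferInstance
  have hproj : Module.Projective R (P.complex.X 0) :=
    (IsProjective.iff_projective _).mpr (P.projective 0)
  let K := LinearMap.range d₁
  let q : P.complex.X 1 →ₗ[R] K := d₁.rangeRestrict
  have hdq : Function.Exact d₂ q := by
    intro x
    rw [← hd x]
    exact Subtype.ext_iff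
  have hKπ : Function.Exact K.subtype π := by
    rw [LinearMap.exact_iff, Submodule.range_subtype]
    exact hd₀.linearMap_ker_eq
  have h1 : IsZero (((Tor' (ModuleCat.{u} R) 1).obj B).obj D) ↔
      Function.Exact (d₂.rTensor D) (d₁.rTensor D) := by
    refine (P.isoLeftDerivedObj T 1).isZero_iff.trans ?_
    refine (HomologicalComplex.exactAt_iff_isZero_homology _ _).symm.trans ?_
    rw [HomologicalComplex.exactAt_iff' _ 2 1 0 (by simp) (by simp)]
    exact ShortComplex.ShortExact.moduleCat_exact_iff_function_exact _
  have h2 : Function.Exact (d₂.rTensor D) (d₁.rTensor D) ↔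
      Function.Injective (K.subtype.rTensor D) :=
    exact_rTensor_comp_iff D d₂ q K.subtype hdq d₁.surjective_rangeRestrict
  rw [h1, h2]
  exact ⟨torVanishes_of_projective K.subtype π hπ hKπ,
    fun h => h _ _ K.subtype π K.injective_subtype hπ hKπ⟩

theorem torOrth_iff (B : ObjectProperty (ModuleCat.{u} R)) (D : ModuleCat.{u} R) :
    torOrth B D ↔ ∀ X : ModuleCat.{u} R, B X → TorVanishes R X D :=
  forall₂_congr fun X _ => isZero_tor_iff X D

theorem TorVanishes.of_linearEquiv {B B' D : Type u} [AddCommGroup B] [Module R B]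
    [AddCommGroup B'] [Module R B'] [AddCommGroup D] [Module R D] (h : TorVanishes R B D)
    (e : B ≃ₗ[R] B') : TorVanishes R B' D := by
  intro X Y _ _ _ _ i p hi hp hip
  refine h X Y i (e.symm.toLinearMap ∘ₗ p) hi (e.symm.surjective.comp hp) fun y => ?_
  rw [← hip y]
  simp

variable {S : Type u} [CommRing S] [Algebra R S] [Module.Flat R S]

/-- By flatness a test sequence over `R` stays exact over `S`, and tensoring it there with `D` gives
the same map. -/
theorem TorVanishes.of_baseChange {B D : Type u} [AddCommGroup B] [Module R B]
    [AddCommGroup D] [Module R D] [Module S D] [IsScalarTower R S D]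
    (h : TorVanishes S (S ⊗[R] B) D) : TorVanishes R B D := by
  intro X Y _ _ _ _ i p hi hp hip
  have := h (S ⊗[R] X) (S ⊗[R] Y) (i.baseChange S) (p.baseChange S)
    (Module.Flat.lTensor_preserves_injective_linearMap i hi) (LinearMap.lTensor_surjective S hp)
    (Module.Flat.lTensor_exact S hip)
  rwa [← LinearMap.lTensor_inj_iff_rTensor_inj, lTensor_baseChange_injective_iff,
    LinearMap.lTensor_inj_iff_rTensor_inj] at this

theorem TorVanishes.baseChange_of_projective {B D P : Type u} [AddCommGroup B] [Module R B]
    [AddCommGroup D] [Module R D] [AddCommGroup P] [Module R P] [Module.Projective R P]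
    (h : TorVanishes R B D) (p : P →ₗ[R] B) (hp : Function.Surjective p) :
    TorVanishes S (S ⊗[R] B) (S ⊗[R] D) := by
  let i := (LinearMap.ker p).subtype
  have hip : Function.Exact i p := by
    rw [LinearMap.exact_iff, Submodule.range_subtype]
  refine torVanishes_of_projective (i.baseChange S) (p.baseChange S)
    (LinearMap.lTensor_surjective S hp) (Module.Flat.lTensor_exact S hip) ?_
  rw [← LinearMap.lTensor_inj_iff_rTensor_inj, lTensor_baseChange_injective_iff]
  have h1 := (LinearMap.lTensor_inj_iff_rTensor_inj D i).mpr
    (h _ _ i p (LinearMap.ker p).injective_subtype hp hip)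
  have h2 := Module.Flat.lTensor_preserves_injective_linearMap (M := S) _ h1
  have h3 : i.lTensor (S ⊗[R] D) = (TensorProduct.assoc R S D P).symm.toLinearMap ∘ₗ
      (i.lTensor D).lTensor S ∘ₗ (TensorProduct.assoc R S D (LinearMap.ker p)).toLinearMap :=
    LinearMap.lTensor_tensor ..
  rw [h3]
  exact ((TensorProduct.assoc R S D _).symm.injective.comp h2).comp
    (TensorProduct.assoc R S D _).injective

theorem TorVanishes.baseChange {B D : Type u} [AddCommGroup B] [Module R B]
    [AddCommGroup D] [Module R D] (h : TorVanishes R B D) :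
    TorVanishes S (S ⊗[R] B) (S ⊗[R] D) :=
  h.baseChange_of_projective (Finsupp.linearCombination R id)
    (Finsupp.linearCombination_id_surjective R B)

end Tor

/-! ### The canonical map into a product of tensor products -/

section PiRightHom

variable {R : Type u} [CommRing R] {I : Type u}

theorem piRightHom_rTensor {M M' : Type u} [AddCommGroup M] [Module R M] [AddCommGroup M']
    [Module R M'] (g : M →ₗ[R] M') (N : I → Type u) [∀ i, AddCommGroup (N i)] [∀ i, Module R (N i)]
    (x : M ⊗[R] (∀ i, N i)) (k : I) :
    piRightHom R R M' N (g.rTensor _ x) k = g.rTensor (N k) (piRightHom R R M N x k) := by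
  induction x with
  | zero => simp
  | add x y hx hy => simp only [map_add, Pi.add_apply, hx, hy]
  | tmul m n => simp

theorem piRightHom_lTensor {M : Type u} [AddCommGroup M] [Module R M] {N E : I → Type u}
    [∀ i, AddCommGroup (N i)] [∀ i, Module R (N i)] [∀ i, AddCommGroup (E i)]
    [∀ i, Module R (E i)] (f : ∀ i, N i →ₗ[R] E i) (x : M ⊗[R] (∀ i, N i)) (k : I) :
    piRightHom R R M E ((LinearMap.piMap f).lTensor M x) k =
      (f k).lTensor M (piRightHom R R M N x k) := by
  induction x with
  | zero => simp
  | add x y hx hy => simp only [map_add, Pi.add_apply, hx, hy]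
  | tmul m n => simp

/-- The canonical map is injective for a module which is a finite sum of retracts for which it is
injective. -/
theorem piRightHom_injective_of_sum_eq_id {ι : Type*} [Fintype ι] {M : Type u} [AddCommGroup M]
    [Module R M] {M' : ι → Type u} [∀ j, AddCommGroup (M' j)] [∀ j, Module R (M' j)]
    (p : ∀ j, M →ₗ[R] M' j) (s : ∀ j, M' j →ₗ[R] M) (h : ∑ j, s j ∘ₗ p j = LinearMap.id)
    (N : I → Type u) [∀ i, AddCommGroup (N i)] [∀ i, Module R (N i)]
    (hM' : ∀ j, Function.Injective (piRightHom R R (M' j) N)) :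
    Function.Injective (piRightHom R R M N) := by
  rw [injective_iff_map_eq_zero]
  intro x hx
  have h1 (j : ι) : (p j).rTensor _ x = 0 := by
    apply hM' j
    rw [map_zero]
    funext k
    rw [piRightHom_rTensor, hx, Pi.zero_apply, map_zero, Pi.zero_apply]
  have h2 : (∑ j, s j ∘ₗ p j).rTensor (∀ i, N i) x = 0 := by
    rw [← LinearMap.coe_rTensorHom, map_sum, LinearMap.sum_apply]
    refine Finset.sum_eq_zero fun j _ => ?_
    rw [LinearMap.coe_rTensorHom, LinearMap.rTensor_comp, LinearMap.comp_apply, h1, map_zero]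
  rwa [h, LinearMap.rTensor_id] at h2

theorem piRightHom_injective_of_linearEquiv {M M' : Type u} [AddCommGroup M] [Module R M]
    [AddCommGroup M'] [Module R M'] (e : M ≃ₗ[R] M') (N : I → Type u) [∀ i, AddCommGroup (N i)]
    [∀ i, Module R (N i)] (h : Function.Injective (piRightHom R R M N)) :
    Function.Injective (piRightHom R R M' N) :=
  piRightHom_injective_of_sum_eq_id (ι := Unit) (M' := fun _ => M) (fun _ => e.symm.toLinearMap)
    (fun _ => e.toLinearMap) (by ext; simp) N fun _ => h

theorem piRightHom_self_bijective (N : I → Type u) [∀ i, AddCommGroup (N i)]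
    [∀ i, Module R (N i)] : Function.Bijective (piRightHom R R R N) := by
  let e := LinearEquiv.piCongrRight fun i => (TensorProduct.lid R (N i)).symm
  have h : piRightHom R R R N = e.toLinearMap ∘ₗ (TensorProduct.lid R (∀ i, N i)).toLinearMap := by
    ext n i
    simp [e]
  rw [h]
  exact e.bijective.comp (TensorProduct.lid R (∀ i, N i)).bijective

variable {S : Type u} [CommRing S] [Algebra R S]

/-- By `hj`, `S` is a direct summand of the `R`-module `R`, for which the map is bijective. -/
theorem piRightHom_bijective_of_retract (j : S →ₗ[R] R)
    (hj : Algebra.linearMap R S ∘ₗ j = LinearMap.id)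
    (N : I → Type u) [∀ i, AddCommGroup (N i)] [∀ i, Module R (N i)] :
    Function.Bijective (piRightHom R S S N) := by
  have hself := piRightHom_self_bijective (R := R) N
  have hc (x : S ⊗[R] (∀ i, N i)) : piRightHom R S S N x = piRightHom R R S N x := rfl
  constructor
  · have := piRightHom_injective_of_sum_eq_id (ι := Unit) (M' := fun _ => R) (fun _ => j)
      (fun _ => Algebra.linearMap R S) (by simpa using hj) N fun _ => hself.1
    exact this
  · intro y
    obtain ⟨z, hz⟩ := hself.2 fun k => j.rTensor (N k) (y k)
    refine ⟨(Algebra.linearMap R S).rTensor _ z, ?_⟩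
    funext k
    rw [hc, piRightHom_rTensor, hz, ← LinearMap.comp_apply, ← LinearMap.rTensor_comp, hj,
      LinearMap.rTensor_id, LinearMap.id_apply]

/-- The isomorphism `(S ⊗ M) ⊗_S N ≃ M ⊗_R N`. -/
noncomputable def baseChangeTensorEquiv (M N : Type u) [AddCommGroup M] [Module R M]
    [AddCommGroup N] [Module R N] [Module S N] [IsScalarTower R S N] :
    (S ⊗[R] M) ⊗[S] N ≃+ M ⊗[R] N :=
  (TensorProduct.comm S (S ⊗[R] M) N).toAddEquiv.trans
    ((AlgebraTensorModule.cancelBaseChange R S S N M).toAddEquiv.trans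
      (TensorProduct.comm R N M).toAddEquiv)

theorem piRightHom_baseChange_injective_iff (M : Type u) [AddCommGroup M] [Module R M]
    (N : I → Type u) [∀ i, AddCommGroup (N i)] [∀ i, Module R (N i)] [∀ i, Module S (N i)]
    [∀ i, IsScalarTower R S (N i)] :
    Function.Injective (piRightHom S S (S ⊗[R] M) N) ↔
      Function.Injective (piRightHom R R M N) := by
  have h : ⇑(piRightHom R R M N) ∘ ⇑(baseChangeTensorEquiv (S := S) M (∀ i, N i)) =
      ⇑(AddEquiv.piCongrRight fun i => baseChangeTensorEquiv (S := S) M (N i)) ∘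
        ⇑(piRightHom S S (S ⊗[R] M) N) := by
    funext x k
    induction x with
    | zero => simp
    | add x y hx hy =>
      simp only [Function.comp_apply, map_add, Pi.add_apply] at *
      rw [hx, hy]
    | tmul t n =>
      induction t with
      | zero => simp
      | add x y hx hy =>
        simp only [Function.comp_apply, map_add, add_tmul, Pi.add_apply] at *
        rw [hx, hy]
      | tmul s m => rfl
  rw [← Function.Injective.of_comp_iff' _ (baseChangeTensorEquiv (S := S) M (∀ i, N i)).bijective,
    h, Function.Injective.of_comp_iff (AddEquiv.injective _)]

/-- Since `S ⊗ ∏ N i` is `∏ (S ⊗ N i)`, the canonical maps over `R` and over `S` agree up to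
isomorphism. -/
theorem piRightHom_injective_of_retract (j : S →ₗ[R] R)
    (hj : Algebra.linearMap R S ∘ₗ j = LinearMap.id) (M : Type u) [AddCommGroup M] [Module R M]
    [Module S M] [IsScalarTower R S M] (N : I → Type u) [∀ i, AddCommGroup (N i)]
    [∀ i, Module R (N i)] (h : Function.Injective (piRightHom S S M fun i => S ⊗[R] N i)) :
    Function.Injective (piRightHom R R M N) := by
  let θ := LinearEquiv.ofBijective _ (piRightHom_bijective_of_retract (S := S) j hj N)
  have hc : ⇑(piRightHom R R M N) ∘
      ⇑(AlgebraTensorModule.cancelBaseChange R S S M (∀ i, N i)) =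
      ⇑(AddEquiv.piCongrRight fun i =>
          (AlgebraTensorModule.cancelBaseChange R S S M (N i)).toAddEquiv) ∘
        ⇑(piRightHom S S M fun i => S ⊗[R] N i) ∘ ⇑(θ.lTensor M) := by
    funext x k
    induction x with
    | zero => simp
    | add x y hx hy =>
      simp only [Function.comp_apply, map_add, Pi.add_apply] at *
      rw [hx, hy]
    | tmul m t =>
      induction t with
      | zero => simp
      | add x y hx hy =>
        simp only [Function.comp_apply, map_add, tmul_add, Pi.add_apply] at *
        rw [hx, hy]
      | tmul s n => rfl
  rw [← Function.Injective.of_comp_iff' _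
    (AlgebraTensorModule.cancelBaseChange R S S M (∀ i, N i)).bijective, hc]
  exact (AddEquiv.injective _).comp (h.comp (θ.lTensor M).injective)

end PiRightHom

/-! ### Ascent and descent -/

variable {𝔯 : RingClass.{u}} {C : ModuleClasses.{u}}

theorem flatML_of_linearEquiv {R : Type u} [CommRing R] {M N : ModuleCat.{u} R} (e : M ≃ₗ[R] N)
    (h : flatML C R M) : flatML C R N := by
  have := h.1
  exact ⟨Module.Flat.of_linearEquiv e.symm, fun I Q hQ =>
    piRightHom_injective_of_linearEquiv e _ (h.2 I Q hQ)⟩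

theorem torVanishes_of_isoClosure {R : Type u} [CommRing R] {B : ObjectProperty (ModuleCat.{u} R)}
    {D : ModuleCat.{u} R} (hD : torOrth B D) {X : ModuleCat.{u} R} (hX : B.isoClosure X) :
    TorVanishes R X D := by
  obtain ⟨Y, hY, ⟨e⟩⟩ := hX
  exact ((torOrth_iff B D).mp hD Y hY).of_linearEquiv e.symm.toLinearEquiv

theorem torVanishes_restrictScalars {R S : Type u} [CommRing R] [CommRing S] [Algebra R S]
    [Module.Flat R S] {B : ModuleCat.{u} R} {D : ModuleCat.{u} S}
    (h : TorVanishes S (S ⊗[R] B) D) :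
    TorVanishes R B ((ModuleCat.restrictScalars (algebraMap R S)).obj D) := by
  let : Module R D := Module.compHom D (algebraMap R S)
  have : IsScalarTower R S D := ⟨fun r s m => by rw [Algebra.smul_def, mul_smul]; rfl⟩
  have h2 := TorVanishes.of_baseChange (D := D) h
  exact h2

/-- The canonical map `M → S ⊗ M`. -/
noncomputable def baseChangeUnit (R S : Type u) [CommRing R] [CommRing S] [Algebra R S]
    (M : ModuleCat.{u} R) :
    M →ₗ[R] (ModuleCat.restrictScalars (algebraMap R S)).obj (ModuleCat.of S (S ⊗[R] M)) :=
  ((baseChangeAdjunction R S).unit.app M).hom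

theorem baseChangeUnit_universallyInjective (R S : Type u) [CommRing R] [CommRing S] [Algebra R S]
    [Module.FaithfullyFlat R S] (M X : ModuleCat.{u} R) :
    Function.Injective ((baseChangeUnit R S M).rTensor X) := by
  -- The identity on elements; it matches the restricted `R`-action with the one on the tensor
  -- product.
  let e : (ModuleCat.restrictScalars (algebraMap R S)).obj (ModuleCat.of S (S ⊗[R] M)) →ₗ[R]
      S ⊗[R] M :=
    { toFun := fun x => x
      map_add' := fun _ _ => rfl
      map_smul' := fun r x => algebraMap_smul S r (show S ⊗[R] M from x) }
  have he : e ∘ₗ baseChangeUnit R S M = TensorProduct.mk R S M 1 := by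
    refine LinearMap.ext fun x => ?_
    rfl
  have h := mk_one_universallyInjective (S := S) M X
  rw [← he, LinearMap.rTensor_comp] at h
  exact Function.Injective.of_comp h

theorem flatML_ascent (h1 : CondC1 𝔯 C) (R S : Type u) [CommRing R] [CommRing S] [Algebra R S]
    (hR : 𝔯 R) (hS : 𝔯 S) (hflat : Module.Flat R S) (M : ModuleCat.{u} R) (hM : flatML C R M) :
    flatML C S (ModuleCat.of S (S ⊗[R] M)) := by
  have := hM.1
  refine ⟨inferInstanceAs (Module.Flat S (S ⊗[R] M)), fun I N hN => ?_⟩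
  have hle : definableClosure (torOrth (C S)) ≤ fun N : ModuleCat.{u} S =>
      definableClosure (torOrth (C R)) ((ModuleCat.restrictScalars (algebraMap R S)).obj N) := by
    refine definableClosure_le (isDefinable_definableClosure _).restrictScalars fun D hD => ?_
    refine le_definableClosure _ _ ((torOrth_iff _ _).mpr fun B hB => ?_)
    have h := torVanishes_of_isoClosure hD
      (h1 R S hR hS hflat (ModuleCat.of S (S ⊗[R] B)) ⟨B, hB, ⟨Iso.refl _⟩⟩)
    exact torVanishes_restrictScalars h
  exact (piRightHom_baseChange_injective_iff (S := S) M
    (fun i => (ModuleCat.restrictScalars (algebraMap R S)).obj (N i))).mpr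
      (hM.2 I _ fun i => hle _ (hN i))

theorem flatML_descent (h2 : CondC2 𝔯 C) (R S : Type u) [CommRing R] [CommRing S] [Algebra R S]
    (hR : 𝔯 R) (hS : IsFiniteProductOf 𝔯 S) (hflat : Module.FaithfullyFlat R S)
    (M : ModuleCat.{u} R) (hM : flatML C S (ModuleCat.of S (S ⊗[R] M))) : flatML C R M := by
  have hM1 : Module.Flat S (S ⊗[R] M) := hM.1
  have hMflat : Module.Flat R M := Module.Flat.of_flat_tensorProduct R M S
  refine ⟨hMflat, fun I N hN => ?_⟩
  have hle : definableClosure (torOrth (C R)) ≤ fun N : ModuleCat.{u} R =>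
      ∃ (E : ModuleCat.{u} S), definableClosure (torOrth (C S)) E ∧
        ∃ f : N →ₗ[R] (ModuleCat.restrictScalars (algebraMap R S)).obj E,
          ∀ X : ModuleCat.{u} R, Function.Injective (f.rTensor X) := by
    refine definableClosure_le (isDefinable_definableClosure _).submodules_restrictScalars
      fun D hD => ⟨ModuleCat.of S (S ⊗[R] D), ?_, ?_⟩
    · rw [h2 R S hR hS hflat]
      refine le_definableClosure _ _ ((torOrth_iff _ _).mpr ?_)
      rintro X ⟨B, hB, ⟨e⟩⟩
      exact (((torOrth_iff _ _).mp hD B hB).baseChange (S := S)).of_linearEquiv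
        e.symm.toLinearEquiv
    · exact ⟨baseChangeUnit R S D, baseChangeUnit_universallyInjective R S D⟩
  choose E hE f hf using fun i => hle _ (hN i)
  have hinj := (piRightHom_baseChange_injective_iff (S := S) M
    (fun i => (ModuleCat.restrictScalars (algebraMap R S)).obj (E i))).mp (hM.2 I E hE)
  rw [injective_iff_map_eq_zero]
  intro x hx
  -- By naturality the image of `x` in `M ⊗ ∏ E i` is in the kernel of an injective map.
  have hx1 : (LinearMap.piMap f).lTensor M x = 0 := by
    apply hinj
    rw [map_zero]
    funext k
    rw [piRightHom_lTensor, hx, Pi.zero_apply, map_zero, Pi.zero_apply]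
  have hf1 := (LinearMap.lTensor_inj_iff_rTensor_inj M _).mpr (piMap_rTensor_injective f hf M)
  exact hf1 (hx1.trans (map_zero _).symm)

/-! ### Finite products of rings -/

section Product

variable {n : ℕ} {R : Fin n → Type u} [∀ i, CommRing (R i)] {S : Type u} [CommRing S]
  [∀ i, Algebra S (R i)] (e : S ≃+* (∀ i, R i)) (he : ∀ i s, algebraMap S (R i) s = e s i)

/-- The section of the projection of a product ring onto a factor. -/
def factorSection (i : Fin n) : R i →ₗ[S] S where
  toFun r := e.symm (Pi.single i r)
  map_add' x y := by rw [Pi.single_add, map_add]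
  map_smul' s r := by
    apply e.injective
    funext j
    rw [RingHom.id_apply, smul_eq_mul, map_mul, Pi.mul_apply, e.apply_symm_apply,
      e.apply_symm_apply]
    by_cases h : j = i
    · subst h
      rw [Pi.single_eq_same, Pi.single_eq_same, Algebra.smul_def, he]
    · rw [Pi.single_eq_of_ne h, Pi.single_eq_of_ne h, mul_zero]

theorem algebraMap_comp_factorSection (i : Fin n) :
    Algebra.linearMap S (R i) ∘ₗ factorSection e he i = LinearMap.id := by
  ext r
  simp [factorSection, he]

theorem flat_factor {n : ℕ} {R : Fin n → Type u} [∀ i, CommRing (R i)] {S : Type u} [CommRing S]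
    [∀ i, Algebra S (R i)] (e : S ≃+* (∀ i, R i)) (he : ∀ i s, algebraMap S (R i) s = e s i)
    (i : Fin n) : Module.Flat S (R i) :=
  Module.Flat.of_retract (factorSection e he i) (Algebra.linearMap S (R i))
    (algebraMap_comp_factorSection e he i)

/-- The map `S → R i` is surjective, so every tensor is `1 ⊗ m`; the idempotent `σ 1` then erases
all coordinates of `m` but the `i`-th. -/
theorem isBaseChange_proj {n : ℕ} {R : Fin n → Type u} [∀ i, CommRing (R i)] {S : Type u}
    [CommRing S] [∀ i, Algebra S (R i)] (e : S ≃+* (∀ i, R i))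
    (he : ∀ i s, algebraMap S (R i) s = e s i) (M : Fin n → Type u) [∀ i, AddCommGroup (M i)]
    [∀ i, Module (R i) (M i)] [∀ i, Module S (M i)] [∀ i, IsScalarTower S (R i) (M i)]
    (i : Fin n) : IsBaseChange (R i) (LinearMap.proj i : (∀ j, M j) →ₗ[S] M i) := by
  let σ := factorSection e he i
  let p : (∀ j, M j) →ₗ[S] M i := LinearMap.proj i
  have hσ (r : R i) : algebraMap S (R i) (σ r) = r :=
    LinearMap.congr_fun (algebraMap_comp_factorSection e he i) r
  have hrep (x : R i ⊗[S] (∀ j, M j)) : ∃ m, x = 1 ⊗ₜ m := by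
    induction x with
    | zero => exact ⟨0, (tmul_zero _ _).symm⟩
    | add x y hx hy =>
      obtain ⟨m, rfl⟩ := hx
      obtain ⟨m', rfl⟩ := hy
      exact ⟨m + m', (tmul_add _ _ _).symm⟩
    | tmul r m =>
      exact ⟨σ r • m, by rw [← smul_tmul, ← Algebra.algebraMap_eq_smul_one, hσ]⟩
  have hact (m : ∀ j, M j) : σ 1 • m = Pi.single i (m i) := by
    funext j
    rw [Pi.smul_apply, ← algebraMap_smul (R j), he]
    have : e (σ 1) = Pi.single i 1 := e.apply_symm_apply _
    rw [this]
    by_cases h : j = i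
    · subst h
      rw [Pi.single_eq_same, Pi.single_eq_same, one_smul]
    · rw [Pi.single_eq_of_ne h, Pi.single_eq_of_ne h, zero_smul]
  have hΦ (m : ∀ j, M j) : p.liftBaseChange (R i) (1 ⊗ₜ m) = m i := by
    rw [LinearMap.liftBaseChange_tmul, one_smul]
    rfl
  have hbij : Function.Bijective (p.liftBaseChange (R i)) := by
    constructor
    · rw [injective_iff_map_eq_zero]
      intro x hx
      obtain ⟨m, rfl⟩ := hrep x
      rw [hΦ] at hx
      rw [← hσ 1, Algebra.algebraMap_eq_smul_one, smul_tmul, hact, hx, Pi.single_zero, tmul_zero]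
    · intro b
      exact ⟨1 ⊗ₜ Pi.single i b, by rw [hΦ, Pi.single_eq_same]⟩
  exact IsBaseChange.of_equiv (LinearEquiv.ofBijective _ hbij) hΦ

end Product

section Product

variable {n : ℕ} {R : Fin n → Type u} [∀ i, CommRing (R i)] {S : Type u} [CommRing S]
  [∀ i, Algebra S (R i)]

/-- The product module, with the `S`-module structures of the factors made explicit. -/
def prodModuleEquiv (e : S ≃+* (∀ i, R i)) (he : ∀ i s, algebraMap S (R i) s = e s i)
    (M : ∀ i, ModuleCat.{u} (R i)) [∀ i, Module S (M i)]
    [∀ i, IsScalarTower S (R i) (M i)] : prodModule e M ≃ₗ[S] ∀ i, M i where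
  toFun x := x
  invFun x := x
  left_inv _ := rfl
  right_inv _ := rfl
  map_add' _ _ := rfl
  map_smul' s x := by
    funext i
    change e s i • (show ∀ i, M i from x) i = s • (show ∀ i, M i from x) i
    rw [← he, algebraMap_smul]

/-- Nonemptiness lets `B` be completed to a family with product in `C_S` by C3; flat base change to
`R i` returns `B`. -/
theorem torOrth_factor (e : S ≃+* (∀ i, R i)) (he : ∀ i s, algebraMap S (R i) s = e s i)
    (hne : ∀ (R : Type u) [CommRing R], 𝔯 R → ∃ M : ModuleCat.{u} R, C R M)
    (h3 : CondC3 𝔯 C) (hR : ∀ i, 𝔯 (R i)) {D : ModuleCat.{u} S} (hD : torOrth (C S) D)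
    (i : Fin n) : torOrth (C (R i)) (ModuleCat.of (R i) (R i ⊗[S] D)) := by
  rw [torOrth_iff]
  intro B hB
  choose A hA using fun i => hne (R i) (hR i)
  let B' : ∀ j, ModuleCat.{u} (R j) := Function.update A i B
  have hB'i : B' i = B := Function.update_self ..
  have hB' (j : Fin n) : C (R j) (B' j) := by
    by_cases h : j = i
    · subst h
      rwa [hB'i]
    · rw [show B' j = A j from Function.update_of_ne h ..]
      exact hA j
  let (j : Fin n) : Module S (B' j) := Module.compHom (B' j) (algebraMap S (R j))
  have (j : Fin n) : IsScalarTower S (R j) (B' j) :=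
    ⟨fun r s m => by rw [Algebra.smul_def, mul_smul]; rfl⟩
  have hT : TorVanishes S (prodModule e B') D := by
    refine torVanishes_of_isoClosure hD ?_
    rw [h3 n R S e hR]
    exact ⟨B', hB', ⟨Iso.refl _⟩⟩
  have hT' : TorVanishes S (∀ j, B' j) D := hT.of_linearEquiv (prodModuleEquiv e he B')
  have := flat_factor e he i
  have hT2 : TorVanishes (R i) (R i ⊗[S] (∀ j, B' j)) (R i ⊗[S] D) := hT'.baseChange
  have hT3 : TorVanishes (R i) (B' i) (R i ⊗[S] D) :=
    hT2.of_linearEquiv (isBaseChange_proj e he (fun j => B' j) i).equiv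
  rwa [hB'i] at hT3

theorem definableClosure_torOrth_factor (e : S ≃+* (∀ i, R i))
    (he : ∀ i s, algebraMap S (R i) s = e s i)
    (hne : ∀ (R : Type u) [CommRing R], 𝔯 R → ∃ M : ModuleCat.{u} R, C R M)
    (h3 : CondC3 𝔯 C) (hR : ∀ i, 𝔯 (R i)) {N : ModuleCat.{u} S}
    (hN : definableClosure (torOrth (C S)) N) (i : Fin n) :
    definableClosure (torOrth (C (R i))) (ModuleCat.of (R i) (R i ⊗[S] N)) := by
  have hdef := isDefinable_definableClosure (torOrth (C (R i)))
  refine definableClosure_le (D := fun N => definableClosure (torOrth (C (R i)))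
    (ModuleCat.of (R i) (R i ⊗[S] N))) (hdef.baseChange fun I N hN => ?_)
    (fun D hD => le_definableClosure _ _ (torOrth_factor e he hne h3 hR hD i)) _ hN
  let θ := LinearEquiv.ofBijective _ (piRightHom_bijective_of_retract (S := R i)
    (factorSection e he i) (algebraMap_comp_factorSection e he i) fun k => N k)
  exact hdef.of_linearEquiv (M := ModuleCat.of (R i) (∀ k, R i ⊗[S] N k))
    (N := ModuleCat.of (R i) (R i ⊗[S] (∀ k, N k))) θ.symm
    (hdef.prod I (fun k => ModuleCat.of (R i) (R i ⊗[S] N k)) hN)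

end Product

theorem flat_pi_of_finite {S : Type u} [CommRing S] {ι : Type*} [Finite ι]
    (M : ι → Type u) [∀ i, AddCommGroup (M i)] [∀ i, Module S (M i)] [∀ i, Module.Flat S (M i)] :
    Module.Flat S (∀ i, M i) := by
  classical
  have := Fintype.ofFinite ι
  exact Module.Flat.of_linearEquiv (DFinsupp.linearEquivFunOnFintype (R := S) (M := M)).symm

theorem flatML_prod (hne : ∀ (R : Type u) [CommRing R], 𝔯 R → ∃ M : ModuleCat.{u} R, C R M)
    (h3 : CondC3 𝔯 C) (n : ℕ) (R : Fin n → Type u) [∀ i, CommRing (R i)] (S : Type u) [CommRing S]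
    (e : S ≃+* (∀ i, R i)) (hR : ∀ i, 𝔯 (R i)) (M : ∀ i, ModuleCat.{u} (R i))
    (hM : ∀ i, flatML C (R i) (M i)) : flatML C S (prodModule e M) := by
  let (i : Fin n) : Algebra S (R i) := ((Pi.evalRingHom R i).comp e.toRingHom).toAlgebra
  have he (i : Fin n) (s : S) : algebraMap S (R i) s = e s i := rfl
  let (i : Fin n) : Module S (M i) := Module.compHom (M i) (algebraMap S (R i))
  have (i : Fin n) : IsScalarTower S (R i) (M i) :=
    ⟨fun r s m => by rw [Algebra.smul_def, mul_smul]; rfl⟩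
  have hflat (i : Fin n) : Module.Flat S (M i) := by
    have := flat_factor e he i
    have := (hM i).1
    exact Module.Flat.trans S (R i) (M i)
  let E := prodModuleEquiv e he M
  refine ⟨?_, fun I N hN => ?_⟩
  · have := flat_pi_of_finite (S := S) fun i => M i
    exact Module.Flat.of_linearEquiv E
  · refine piRightHom_injective_of_linearEquiv E.symm _ ?_
    -- The identity of the product is the sum of the coordinate projections followed by inclusions,
    -- so each `M i` can be treated alone.
    refine piRightHom_injective_of_sum_eq_id (M' := fun i => M i) (fun i => LinearMap.proj i)
      (fun i => LinearMap.single S (fun i => M i) i) ?_ _ fun i => ?_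
    · refine LinearMap.ext fun x => ?_
      rw [LinearMap.sum_apply]
      exact Finset.univ_sum_single x
    · exact piRightHom_injective_of_retract (factorSection e he i)
        (algebraMap_comp_factorSection e he i) (M i) (fun k => N k)
        ((hM i).2 I (fun k => ModuleCat.of (R i) (R i ⊗[S] N k)) fun k =>
          definableClosure_torOrth_factor e he hne h3 hR (hN k) i)

theorem isAdProperty_flatML
    (hne : ∀ (R : Type u) [CommRing R], 𝔯 R → ∃ M : ModuleCat.{u} R, C R M)
    (h1 : CondC1 𝔯 C) (h2 : CondC2 𝔯 C) (h3 : CondC3 𝔯 C) : IsAdProperty 𝔯 (flatML C) where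
  ascent := flatML_ascent h1
  descent := flatML_descent h2
  prod := flatML_prod hne h3

/-! ### Quasi-coherent sections over basic opens -/

section BasicOpen

variable {X : Scheme.{u}}

theorem fromSpec_image_le {U : X.Opens} (hU : IsAffineOpen U) (V : (Spec Γ(X, U)).Opens) :
    hU.fromSpec ''ᵁ V ≤ U :=
  (hU.fromSpec.image_le_opensRange V).trans_eq hU.opensRange_fromSpec

/-- Needed to match the scalar action of `Γ(X, U)` on the spectrum side with restriction on `X`. -/
theorem ΓSpecIso_inv_comp_appIso_inv {U : X.Opens} (hU : IsAffineOpen U)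
    (V : (Spec Γ(X, U)).Opens) :
    (Scheme.ΓSpecIso _).inv ≫ (Spec Γ(X, U)).presheaf.map V.leTop.op ≫ (hU.fromSpec.appIso V).inv
      = X.presheaf.map (homOfLE (fromSpec_image_le hU V)).op := by
  rw [← Category.assoc, Iso.comp_inv_eq, Scheme.Hom.appIso_hom', Scheme.Hom.map_appLE,
    Scheme.Hom.appLE, hU.fromSpec_app_self]
  simp only [Category.assoc, ← Functor.map_comp]
  rfl

theorem smul_restrict_fromSpec (M : X.Modules) {U : X.Opens} (hU : IsAffineOpen U)
    (V : (Spec Γ(X, U)).Opens) (r : Γ(X, U)) (x : Γ(M.restrict hU.fromSpec, V)) :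
    (M.restrictAppIso hU.fromSpec V).hom (r • x) =
      X.presheaf.map (homOfLE (fromSpec_image_le hU V)).op r •
        (M.restrictAppIso hU.fromSpec V).hom x := by
  rw [Scheme.Modules.smul_Spec_def, Scheme.Modules.smul_restrictAppIso_hom_apply,
    ← ΓSpecIso_inv_comp_appIso_inv]
  rfl

/-- The restriction of the sections of `M` from `W` to `W'` is the localization at `f`. -/
structure RestrictsToLocalization (M : X.Modules) {U : X.Opens} (f : Γ(X, U)) (W W' : X.Opens)
    (h : W ≤ U) (h' : W' ≤ W) : Prop where
  surj : ∀ y : Γ(M, W'), ∃ (n : ℕ) (x : Γ(M, W)), M.presheaf.map (homOfLE h').op x =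
    X.presheaf.map (homOfLE (h'.trans h)).op (f ^ n) • y
  exists_of_eq_zero : ∀ x : Γ(M, W), M.presheaf.map (homOfLE h').op x = 0 →
    ∃ n : ℕ, X.presheaf.map (homOfLE h).op (f ^ n) • x = 0

theorem restrictsToLocalization_image (M : X.Modules) [M.IsQuasicoherent] {U : X.Opens}
    (hU : IsAffineOpen U) (f : Γ(X, U)) :
    RestrictsToLocalization M f (hU.fromSpec ''ᵁ ⊤) (hU.fromSpec ''ᵁ (PrimeSpectrum.basicOpen f))
      (fromSpec_image_le hU _) (hU.fromSpec.image_mono le_top) := by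
  have hq : (M.restrict hU.fromSpec).IsQuasicoherent :=
    Scheme.Modules.isQuasicoherent_restrictFunctor hU.fromSpec M
  have hl := (isIso_fromTildeΓ_iff_isLocalizing (M.restrict hU.fromSpec)).mp inferInstance f
  constructor
  · intro y
    obtain ⟨⟨x, ⟨_, n, rfl⟩⟩, hx⟩ := hl.surj y
    refine ⟨n, x, ?_⟩
    have := smul_restrict_fromSpec M hU (PrimeSpectrum.basicOpen f) (f ^ n) y
    exact hx.symm.trans this
  · intro x hx
    obtain ⟨⟨_, n, rfl⟩, hn⟩ := hl.exists_of_eq (x₁ := x) (x₂ := 0) (by rw [map_zero]; exact hx)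
    refine ⟨n, ?_⟩
    have := smul_restrict_fromSpec M hU ⊤ (f ^ n) x
    rw [smul_zero] at hn
    exact this.symm.trans hn

theorem restrictsToLocalization_basicOpen (M : X.Modules) [M.IsQuasicoherent] {U : X.Opens}
    (hU : IsAffineOpen U) (f : Γ(X, U)) :
    RestrictsToLocalization M f U (X.basicOpen f) le_rfl (X.basicOpen_le f) := by
  have h := restrictsToLocalization_image M hU f
  have h1 : hU.fromSpec ''ᵁ ⊤ = U := by
    rw [Scheme.Hom.image_top_eq_opensRange, hU.opensRange_fromSpec]
  have h2 := hU.fromSpec_image_basicOpen f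
  -- Generalizing both opens lets the equalities be substituted without transporting sections.
  have key : ∀ {W W' : X.Opens} (hW : W = U) (hW' : W' = X.basicOpen f) (a : W ≤ U) (b : W' ≤ W),
      RestrictsToLocalization M f W W' a b →
      RestrictsToLocalization M f U (X.basicOpen f) le_rfl (X.basicOpen_le f) := by
    rintro _ _ rfl rfl _ _ h
    exact h
  exact key h1 h2 _ _ h

end BasicOpen

/-! ### Descent along finite basic covers -/

section Gluing

variable {R : Type u} [CommRing R] {n : ℕ} {S : Fin n → Type u} [∀ i, CommRing (S i)]
  [∀ i, Algebra R (S i)]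

theorem isBaseChange_pi_algebra {M : Type u} [AddCommGroup M] [Module R M] {N : Fin n → Type u}
    [∀ i, AddCommGroup (N i)] [∀ i, Module R (N i)] [∀ i, Module (S i) (N i)]
    [∀ i, IsScalarTower R (S i) (N i)] (φ : ∀ i, M →ₗ[R] N i)
    (hφ : ∀ i, IsBaseChange (S i) (φ i)) :
    IsBaseChange (∀ i, S i) (LinearMap.pi φ) := by
  let E : (∀ i, S i) ⊗[R] M ≃ₗ[R] ∀ i, N i := TensorProduct.piLeft R M S ≪≫ₗ
    LinearEquiv.piCongrRight fun i => (hφ i).equiv.restrictScalars R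
  have h : TensorProduct.lift (((Algebra.linearMap (∀ i, S i) <| Module.End (∀ i, S i)
      (M →ₗ[R] ∀ i, N i)).flip (LinearMap.pi φ)).restrictScalars R) = E.toLinearMap := by
    refine TensorProduct.ext' fun s m => funext fun i => ?_
    simp [E, IsBaseChange.equiv_tmul]
  change Function.Bijective _
  rw [h]
  exact E.bijective

/-- A prime omits some `f i`, hence is in the image of the spectrum of `S i`. -/
theorem faithfullyFlat_pi_away (f : Fin n → R) (hf : Ideal.span (Set.range f) = ⊤)
    [∀ i, IsLocalization.Away (f i) (S i)] : Module.FaithfullyFlat R (∀ i, S i) := by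
  have (i : Fin n) : Module.Flat R (S i) := IsLocalization.flat _ (Submonoid.powers (f i))
  have := flat_pi_of_finite (S := R) S
  refine Module.FaithfullyFlat.of_comap_surjective fun p => ?_
  have hi : ∃ i, f i ∉ p.asIdeal := by
    by_contra! h
    refine p.isPrime.ne_top (top_le_iff.mp (hf ▸ Ideal.span_le.mpr ?_))
    rintro _ ⟨i, rfl⟩
    exact h i
  obtain ⟨i, hi⟩ := hi
  have hp : p ∈ Set.range (PrimeSpectrum.comap (algebraMap R (S i))) := by
    rw [PrimeSpectrum.localization_away_comap_range (S i) (f i)]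
    exact hi
  obtain ⟨q, rfl⟩ := hp
  exact ⟨PrimeSpectrum.comap (Pi.evalRingHom S i) q, rfl⟩

variable {P : ModuleClasses.{u}}

/-- The product of the `S i` need not be in `𝔯`; this is where descent to finite products of such
rings is used. -/
theorem IsAdProperty.of_pi_away (hP : IsAdProperty 𝔯 P)
    (hiso : ∀ (R : Type u) [CommRing R] {M N : ModuleCat.{u} R}, (M ≃ₗ[R] N) → P R M → P R N)
    (hR : 𝔯 R) (hS : ∀ i, 𝔯 (S i)) (f : Fin n → R) (hf : Ideal.span (Set.range f) = ⊤)
    [∀ i, IsLocalization.Away (f i) (S i)] (M : ModuleCat.{u} R) (N : ∀ i, ModuleCat.{u} (S i))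
    [∀ i, Module R (N i)] [∀ i, IsScalarTower R (S i) (N i)] (φ : ∀ i, M →ₗ[R] N i)
    (hφ : ∀ i, IsBaseChange (S i) (φ i)) (hN : ∀ i, P (S i) (N i)) : P R M := by
  have hff := faithfullyFlat_pi_away (S := S) f hf
  refine hP.descent R (∀ i, S i) hR ⟨n, S, _, hS, ⟨RingEquiv.refl _⟩⟩ hff M ?_
  have hprod := hP.prod n S (∀ i, S i) (RingEquiv.refl _) hS N hN
  let E : prodModule (RingEquiv.refl (∀ i, S i)) N ≃ₗ[∀ i, S i] ∀ i, N i :=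
    { toFun := fun x => x
      invFun := fun x => x
      left_inv := fun _ => rfl
      right_inv := fun _ => rfl
      map_add' := fun _ _ => rfl
      map_smul' := fun _ _ => rfl }
  have e := (isBaseChange_pi_algebra φ hφ).equiv
  exact hiso _ (E ≪≫ₗ e.symm) hprod

end Gluing

theorem IsAdProperty.of_isBaseChange {P : ModuleClasses.{u}}
    (hP : IsAdProperty 𝔯 P)
    (hiso : ∀ (R : Type u) [CommRing R] {M N : ModuleCat.{u} R}, (M ≃ₗ[R] N) → P R M → P R N)
    {R S : Type u} [CommRing R] [CommRing S] [Algebra R S] [Module.Flat R S]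
    (hR : 𝔯 R) (hS : 𝔯 S) (M : ModuleCat.{u} R) (N : ModuleCat.{u} S) [Module R N]
    [IsScalarTower R S N] {φ : M →ₗ[R] N} (hφ : IsBaseChange S φ) (hM : P R M) : P S N :=
  hiso S (M := ModuleCat.of S (S ⊗[R] M)) hφ.equiv (hP.ascent R S hR hS inferInstance M hM)

/-! ### Restriction to a basic open as base change, and Zariski locality -/

section Sections

variable {X : Scheme.{u}} (M : X.Modules) {U : X.Opens} (f : Γ(X, U))

/-- The `Γ(X, U)`-module structure on the sections of `M` over a basic open subset of `U`. -/
noncomputable abbrev moduleBasicOpen : Module Γ(X, U) Γ(M, X.basicOpen f) :=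
  Module.compHom _ (algebraMap Γ(X, U) Γ(X, X.basicOpen f))

theorem isScalarTower_basicOpen :
    letI := moduleBasicOpen M f
    IsScalarTower Γ(X, U) Γ(X, X.basicOpen f) Γ(M, X.basicOpen f) :=
  letI := moduleBasicOpen M f
  ⟨fun r s m => by rw [Algebra.smul_def, mul_smul]; rfl⟩

/-- The restriction of sections of `M` to a basic open set, as a linear map. -/
noncomputable def restrictBasicOpen :
    letI := moduleBasicOpen M f
    Γ(M, U) →ₗ[Γ(X, U)] Γ(M, X.basicOpen f) :=
  letI := moduleBasicOpen M f
  { toFun := M.presheaf.map (homOfLE (X.basicOpen_le f)).op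
    map_add' := map_add _
    map_smul' := Scheme.Modules.map_smul M (homOfLE (X.basicOpen_le f)) }

theorem isBaseChange_restrictBasicOpen [M.IsQuasicoherent] (hU : IsAffineOpen U) :
    letI := moduleBasicOpen M f
    haveI := isScalarTower_basicOpen M f
    IsBaseChange Γ(X, X.basicOpen f) (restrictBasicOpen M f) := by
  let := moduleBasicOpen M f
  have := isScalarTower_basicOpen M f
  have := hU.isLocalization_basicOpen f
  rw [← isLocalizedModule_iff_isBaseChange (Submonoid.powers f)]
  have h := restrictsToLocalization_basicOpen M hU f
  have hz (x : Γ(M, U)) (hx : restrictBasicOpen M f x = 0) : ∃ n : ℕ, f ^ n • x = 0 := by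
    obtain ⟨n, hn⟩ := h.exists_of_eq_zero x hx
    refine ⟨n, ?_⟩
    have hid : X.presheaf.map (homOfLE (le_refl U)).op (f ^ n) = f ^ n := by
      simp
    rwa [hid] at hn
  refine ⟨fun x => ?_, fun y => ?_, fun {x₁ x₂} hx => ?_⟩
  · rw [Module.End.isUnit_iff]
    have hu := IsLocalization.map_units Γ(X, X.basicOpen f) x
    exact MulAction.bijective (β := Γ(M, X.basicOpen f)) hu.unit
  · obtain ⟨n, x, hx⟩ := h.surj y
    exact ⟨⟨x, ⟨f ^ n, n, rfl⟩⟩, hx.symm⟩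
  · obtain ⟨n, hn⟩ := hz (x₁ - x₂) (by rw [map_sub, hx, sub_self])
    refine ⟨⟨f ^ n, n, rfl⟩, ?_⟩
    rw [smul_sub] at hn
    exact sub_eq_zero.mp hn

end Sections

/-- The affine communication lemma leaves two checks: passage to a basic open, which is ascent along
a localization, and passage back from basic opens whose functions generate the unit ideal. -/
theorem isZariskiLocal_of_isAdProperty {P : ModuleClasses.{u}}
    (hP : IsAdProperty 𝔯 P)
    (hiso : ∀ (R : Type u) [CommRing R] {M N : ModuleCat.{u} R}, (M ≃ₗ[R] N) → P R M → P R N) :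
    IsZariskiLocal 𝔯 P := by
  intro X hX 𝒱 h𝒱 hcov M hM hP𝒱
  refine ⟨hM, fun U hU => ?_⟩
  refine of_affine_open_cover (P := fun V : X.affineOpens => SectionsSatisfy P M V)
    (fun V : 𝒱 => ⟨V.1, h𝒱 V.1 V.2⟩) (by rw [← hcov, sSup_eq_iSup']) ⟨U, hU⟩ ?_ ?_
    (fun V => hP𝒱 V.1 V.2)
  · intro V f hV
    let := moduleBasicOpen M f
    have := isScalarTower_basicOpen M f
    have := V.2.isLocalization_basicOpen f
    have : Module.Flat Γ(X, V) Γ(X, X.basicOpen f) := IsLocalization.flat _ (Submonoid.powers f)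
    exact hP.of_isBaseChange hiso (hX _ V.2) (hX _ (V.2.basicOpen f)) (ModuleCat.of _ _)
      (ModuleCat.of _ Γ(M, X.basicOpen f)) (isBaseChange_restrictBasicOpen M f V.2) hV
  · intro V s hs hV
    let f : Fin s.card → Γ(X, V) := fun i => (s.equivFin.symm i).1
    have hf : Ideal.span (Set.range f) = ⊤ := by
      rw [← hs]
      congr 1
      change Set.range (Subtype.val ∘ s.equivFin.symm) = _
      rw [s.equivFin.symm.surjective.range_comp, Subtype.range_coe]
    let (i : Fin s.card) := moduleBasicOpen M (f i)
    have (i : Fin s.card) := isScalarTower_basicOpen M (f i)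
    have (i : Fin s.card) := V.2.isLocalization_basicOpen (f i)
    exact hP.of_pi_away hiso (S := fun i => Γ(X, X.basicOpen (f i))) (hX _ V.2)
      (fun i => hX _ (V.2.basicOpen (f i))) f hf (ModuleCat.of _ _)
      (fun i => ModuleCat.of _ Γ(M, X.basicOpen (f i)))
      (fun i => restrictBasicOpen M (f i))
      (fun i => isBaseChange_restrictBasicOpen M (f i) V.2)
      (fun i => hV (s.equivFin.symm i))

end RelML

theorem theorem4p5 (𝔯 : RelML.RingClass.{u}) (C : RelML.ModuleClasses.{u})
    (hne : ∀ (R : Type u) [CommRing R], 𝔯 R → ∃ M : ModuleCat.{u} R, C R M)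
    (h1 : RelML.CondC1 𝔯 C) (h2 : RelML.CondC2 𝔯 C) (h3 : RelML.CondC3 𝔯 C) :
    RelML.IsAdProperty 𝔯 (RelML.flatML C) ∧ RelML.IsZariskiLocal 𝔯 (RelML.flatML C) :=
  have h := RelML.isAdProperty_flatML hne h1 h2 h3
  ⟨h, RelML.isZariskiLocal_of_isAdProperty h fun _ _ _ _ e => RelML.flatML_of_linearEquiv e⟩
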